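/- Let $T>0$ and let $\{\Omega(t)\}_{t\in\mathbb R}$ be a family of bounded domains in $\mathbb R^3$ with $C^\infty$ boundary such that: (i) there are a domain $\widetilde\Omega\subset\mathbb R^3$ and a level-preserving $C^\infty$ diffeomorphism $\Phi(x,t)=(\phi(x,t),t)$ from $\overline{Q_\infty}$ onto $\overline{\widetilde\Omega\times\mathbb R}$, where $Q_\infty=\bigcup_{t}\Omega(t)\times\{t\}$, with $\phi(\Omega(t),t)=\widetilde\Omega$ and with $\det(\partial\phi^i/\partial x^j)(x,t)=J(t)^{-1}>0$ depending on $t$ only; $\phi^{-1}(\cdot,t)$ denotes the inverse of $\phi(\cdot,t)$; (ii) there is $K\in\mathbb N\cup\{0\}$ such that, for every $t$, $\partial\Omega(t)$ has exactly $K+1$ connected components $\Gamma_0(t),\dots,\Gamma_K(t)$, where $\Gamma_1(t),\dots,\Gamma_K(t)$ lie inside $\Gamma_0(t)$; and there is $L\in\mathbb N\cup\{0\}$ such that, for every $t$, $\Omega(t)$ becomes simply connected after removing $L$ mutually disjoint $C^\infty$ surfaces transversal to $\partial\Omega(t)$. Assume $\phi^{-1}(\cdot,t+T)=\phi^{-1}(\cdot,t)$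 for all $t$, and $\Omega(t)=\lambda(t)\Omega(0)=\{\lambda(t)x: x\in\Omega(0)\}$ with $\lambda\in C^\infty(\mathbb R)$, $\lambda(t)>0$, $\lambda(t+T)=\lambda(t)$ for all $t\in\mathbb R$. Let $\nu(t)$ be the outward unit normal to $\partial\Omega(t)$, and let $\beta(t)\in H^{1/2}(\partial\Omega(t))$ be vector fields with $\int_{\partial\Omega(t)}\beta(t)\cdot\nu(t)\,dS=0$ and $\beta(t+T)=\beta(t)$ for all $t\in\mathbb R$, such that $\widetilde\beta\in C^1(\mathbb R;H^{1/2}(\partial\widetilde\Omega))$, where $$\widetilde\beta^{\,i}(y,t)=\sum_{\ell}\frac{\partial\phi^i}{\partial x^\ell}(\phi^{-1}(y,t),t)\,\beta^\ell(\phi^{-1}(y,t),t).$$ For $k=1,\dots,K$ let $q_k(t)\in C^\infty(\overline{\Omega(t)})$ be the solution of $\Delta q_k(t)=0$ in $\Omega(t)$, $q_k(t)=\delta_{kj}$ on $\Gamma_j(t)$, $j=0,\dots,K$. Let $\eta_1(t),\dots,\eta_K(t)$ be obtained from $\nabla q_1(t),\dots,\nabla q_K(t)$ by the Gram–Schmidt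 orthonormalization in $L^2(\Omega(t))$, and write $\eta_j(t)=\sum_{k=1}^K\alpha_{jk}(t)\nabla q_k(t)$, with $\alpha_{jk}(t)=0$ for $k>j$. Let $C_s=3^{-1/2}2^{2/3}\pi^{-2/3}$. Then there is a constant $C_0>0$, depending only on $\Omega(0)$, such that if $$\frac1{\lambda(t)}\sum_{k=1}^K\left|\int_{\Gamma_k(t)}\beta(t)\cdot\nu(t)\,dS\right|<C_0\qquad\text{for all }t\in[0,T],$$ then $$\sup_{0\le t\le T}\left\|\sum_{\ell,k=1}^K\alpha_{k\ell}(t)\left(\int_{\Gamma_\ell(t)}\beta(t)\cdot\nu(t)\,dS\right)\eta_k(t)\right\|_{L^3(\Omega(t))}<\frac1{C_s},$$ which is the smallness hypothesis of the existence theorem for time-periodic solutions of the Navier–Stokes equations on $\Omega(t)$. -/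

import Mathlib

open Set Filter Topology MeasureTheory
open scoped ContDiff Gradient Laplacian

noncomputable section

/-- Three-dimensional Euclidean space. -/
abbrev E3 : Type := EuclideanSpace ℝ (Fin 3)

/-! ### Bounded domains with smooth boundary -/

/-- `ρ` is a smooth local defining function of `Ω` on the open set `U`. -/
structure IsLocalDefiningFunction (Ω U : Set E3) (ρ : E3 → ℝ) : Prop where
  isOpen : IsOpen U
  smooth : ContDiffOn ℝ ∞ ρ U
  gradient_ne_zero : ∀ y ∈ U, ∇ ρ y ≠ 0
  inter_eq : Ω ∩ U = {y | ρ y < 0} ∩ U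

/-- A bounded domain (nonempty connected open set) of `ℝ³` with `C^∞` boundary. -/
structure IsSmoothBoundedDomain (Ω : Set E3) : Prop where
  isOpen : IsOpen Ω
  isConnected : IsConnected Ω
  isBounded : Bornology.IsBounded Ω
  smooth_boundary : ∀ x ∈ frontier Ω, ∃ U : Set E3, ∃ ρ : E3 → ℝ,
    x ∈ U ∧ IsLocalDefiningFunction Ω U ρ

/-- `n` is the outward unit normal vector to `∂Ω` at `x`. -/
def IsOutwardUnitNormal (Ω : Set E3) (x n : E3) : Prop :=
  ∃ U : Set E3, ∃ ρ : E3 → ℝ, x ∈ U ∧ IsLocalDefiningFunction Ω U ρ ∧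
    n = ‖∇ ρ x‖⁻¹ • ∇ ρ x

/-- The outward unit normal vector field `ν` on `∂Ω`. -/
def outwardNormal (Ω : Set E3) (x : E3) : E3 :=
  Classical.epsilon (IsOutwardUnitNormal Ω x)

/-- The surface measure `dS`: the two-dimensional Hausdorff measure, normalized so that it agrees
with the Lebesgue measure on planes. -/
abbrev surfaceMeasure : Measure E3 := μHE[2]

/-- The flux `∫_S b · ν dS` through a part `S` of `∂Ω`. -/
def flux (Ω S : Set E3) (b : E3 → E3) : ℝ :=
  ∫ x in S, inner ℝ (b x) (outwardNormal Ω x) ∂surfaceMeasure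

/-- `Γ 0, …, Γ K` are the connected components of `∂Ω` (pairwise disjoint closed connected sets
with union `∂Ω`), and `Γ 1, …, Γ K` lie inside `Γ 0`, i.e. in bounded components of its
complement. -/
structure IsBoundaryLabelling {K : ℕ} (Ω : Set E3) (Γ : Fin (K + 1) → Set E3) : Prop where
  isClosed : ∀ k, IsClosed (Γ k)
  isConnected : ∀ k, IsConnected (Γ k)
  disjoint : ∀ k l, k ≠ l → Disjoint (Γ k) (Γ l)
  iUnion_eq : ⋃ k, Γ k = frontier Ω
  inside : ∀ k, k ≠ 0 → ∀ x ∈ Γ k, Bornology.IsBounded (connectedComponentIn (Γ 0)ᶜ x)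

/-- `S` is a `C^∞` surface in `closure Ω` which meets `∂Ω` transversally (along its own
boundary). -/
structure IsTransversalSurface (Ω S : Set E3) : Prop where
  isClosed : IsClosed S
  subset : S ⊆ closure Ω
  smooth : ∀ x ∈ S, ∃ U : Set E3, ∃ σ : E3 → ℝ, IsOpen U ∧ x ∈ U ∧ ContDiffOn ℝ ∞ σ U ∧
    (∀ y ∈ U, ∇ σ y ≠ 0) ∧ S ∩ U = {y | σ y = 0} ∩ closure Ω ∩ U ∧
    (x ∈ frontier Ω → LinearIndependent ℝ ![∇ σ x, outwardNormal Ω x])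

/-- Cutting `Ω` along the disjoint transversal surfaces `S 1, …, S L` leaves a simply connected
domain. -/
structure IsCutSystem {L : ℕ} (Ω : Set E3) (S : Fin L → Set E3) : Prop where
  surface : ∀ l, IsTransversalSurface Ω (S l)
  disjoint : ∀ l m, l ≠ m → Disjoint (S l) (S m)
  simplyConnected : IsSimplyConnected (Ω \ ⋃ l, S l)

/-! ### The time dependent domain -/

/-- The noncylindrical space-time domain `⋃ₜ Ω(t) × {t}`. -/
def spaceTime (Ω : ℝ → Set E3) : Set (E3 × ℝ) := {p | p.1 ∈ Ω p.2}

/-- The spatial Jacobian matrix `∂φ/∂x (x, t)` on `closure Ω(t)`, as a linear map. -/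
def spatialDeriv (Ω : ℝ → Set E3) (φ : E3 × ℝ → E3) (x : E3) (t : ℝ) : E3 →L[ℝ] E3 :=
  fderivWithin ℝ (fun z => φ (z, t)) (closure (Ω t)) x

/-- `(x, t) ↦ (φ (x, t), t)` is a level-preserving `C^∞` diffeomorphism of the closure of
`⋃ₜ Ω(t) × {t}` onto the closure of the cylinder `Ω' × ℝ`, with inverse `(y, s) ↦ (ψ (y, s), s)`,
and its spatial Jacobian determinant is positive and depends on time only. -/
structure IsLevelDiffeo (Ω : ℝ → Set E3) (Ω' : Set E3) (φ ψ : E3 × ℝ → E3) : Prop where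
  isOpen : IsOpen Ω'
  isConnected : IsConnected Ω'
  smooth : ContDiffOn ℝ ∞ φ (closure (spaceTime Ω))
  smooth_inv : ContDiffOn ℝ ∞ ψ (closure (Ω' ×ˢ univ))
  mapsTo : ∀ p ∈ closure (spaceTime Ω), (φ p, p.2) ∈ closure (Ω' ×ˢ (univ : Set ℝ))
  mapsTo_inv : ∀ p ∈ closure (Ω' ×ˢ (univ : Set ℝ)), (ψ p, p.2) ∈ closure (spaceTime Ω)
  left_inv : ∀ p ∈ closure (spaceTime Ω), ψ (φ p, p.2) = p.1
  right_inv : ∀ p ∈ closure (Ω' ×ˢ (univ : Set ℝ)), φ (ψ p, p.2) = p.1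
  image_eq : ∀ t, (fun x => φ (x, t)) '' Ω t = Ω'
  jacobian : ∃ J : ℝ → ℝ, ∀ t, 0 < J t ∧
    ∀ x ∈ closure (Ω t), (spatialDeriv Ω φ x t).det = (J t)⁻¹

/-- The standing assumption on the family `Ω(t)`, with boundary components
`Γ_0(t), …, Γ_K(t)`, reference domain `Ω'` and diffeomorphism `φ` with inverse `ψ`. -/
structure IsAdmissibleFamily {K : ℕ} (Ω : ℝ → Set E3) (Γ : ℝ → Fin (K + 1) → Set E3)
    (Ω' : Set E3) (φ ψ : E3 × ℝ → E3) : Prop where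
  domain : ∀ t, IsSmoothBoundedDomain (Ω t)
  diffeo : IsLevelDiffeo Ω Ω' φ ψ
  boundary : ∀ t, IsBoundaryLabelling (Ω t) (Γ t)
  cuts : ∃ L : ℕ, ∀ t, ∃ S : Fin L → Set E3, IsCutSystem (Ω t) S

/-- The transform `b̃ⁱ(y, t) = ∑ₗ ∂φⁱ/∂xˡ(ψ(y, t), t) bˡ(ψ(y, t), t)` of a time dependent vector
field. -/
def transformField (Ω : ℝ → Set E3) (φ ψ : E3 × ℝ → E3) (b : ℝ → E3 → E3) :
    ℝ → E3 → E3 :=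
  fun t y => spatialDeriv Ω φ (ψ (y, t)) t (b t (ψ (y, t)))

/-! ### The space `H^{1/2}` of vector fields on a closed surface -/

/-- The squared Sobolev-Slobodeckij norm of `H^{1/2}(S)`, for a surface `S`. -/
def hHalfNormSq (S : Set E3) (f : E3 → E3) : ENNReal :=
  (∫⁻ x in S, ‖f x‖ₑ ^ 2 ∂surfaceMeasure) +
    ∫⁻ x in S, ∫⁻ y in S, ‖f x - f y‖ₑ ^ 2 / ‖x - y‖ₑ ^ 3 ∂surfaceMeasure ∂surfaceMeasure

/-- `f ∈ H^{1/2}(S)`. -/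
def MemHHalf (S : Set E3) (f : E3 → E3) : Prop :=
  AEStronglyMeasurable f (surfaceMeasure.restrict S) ∧ hHalfNormSq S f < ⊤

/-- `f ∈ C¹(ℝ; H^{1/2}(S))`. -/
def IsC1HHalf (S : Set E3) (f : ℝ → E3 → E3) : Prop :=
  (∀ t, MemHHalf S (f t)) ∧ ∃ g : ℝ → E3 → E3, (∀ t, MemHHalf S (g t)) ∧
    (∀ t, Tendsto (fun h : ℝ => hHalfNormSq S (h⁻¹ • (f (t + h) - f t) - g t))
      (𝓝[≠] 0) (𝓝 0)) ∧
    ∀ t, Tendsto (fun s : ℝ => hHalfNormSq S (g s - g t)) (𝓝 t) (𝓝 0)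

/-! ### Harmonic vector fields and the smallness condition -/

/-- `q ∈ C^∞(closure Ω)` solves `Δ q = 0` in `Ω`, `q = 1` on `Γ_k`, `q = 0` on the other boundary
components. Here `k : Fin K` stands for the index `k + 1 ∈ {1, …, K}`. -/
structure IsHarmonicPotential {K : ℕ} (Ω : Set E3) (Γ : Fin (K + 1) → Set E3) (k : Fin K)
    (q : E3 → ℝ) : Prop where
  smooth : ContDiffOn ℝ ∞ q (closure Ω)
  harmonic : ∀ x ∈ Ω, Δ q x = 0
  boundary : ∀ j, ∀ x ∈ Γ j, q x = if j = k.succ then 1 else 0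

/-- The `L²(Ω)` inner product of vector fields. -/
def l2Inner (Ω : Set E3) (u v : E3 → E3) : ℝ := ∫ x in Ω, inner ℝ (u x) (v x)

/-- The `L²(Ω)` norm of a vector field. -/
def l2Norm (Ω : Set E3) (u : E3 → E3) : ℝ := Real.sqrt (l2Inner Ω u u)

/-- The linear combination `∑ₖ cₖ vₖ` of vector fields. -/
def combination {K : ℕ} (v : Fin K → E3 → E3) (c : Fin K → ℝ) : E3 → E3 := ∑ k, c k • v k

/-- The coefficients `α_{j1}, …, α_{jK}` of the Gram-Schmidt orthonormalization of
`v_1, …, v_K` in `L²(Ω)`. -/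
def gramSchmidtCoeff {K : ℕ} (Ω : Set E3) (v : Fin K → E3 → E3) (j : Fin K) : Fin K → ℝ :=
  let r : Fin K → ℝ := Pi.single j 1 -
    ∑ i : Finset.Iio j, l2Inner Ω (v j) (combination v (gramSchmidtCoeff Ω v i)) •
      gramSchmidtCoeff Ω v i
  (l2Norm Ω (combination v r))⁻¹ • r
termination_by j
decreasing_by exact Fin.lt_def.1 (Finset.mem_Iio.1 i.2)

/-- `α_{jk}`: the Gram-Schmidt coefficients of `∇q_1, …, ∇q_K` in `L²(Ω)`. -/
def alphaCoeff {K : ℕ} (Ω : Set E3) (q : Fin K → E3 → ℝ) (j k : Fin K) : ℝ :=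
  gramSchmidtCoeff Ω (fun l => ∇ (q l)) j k

/-- `η_j = ∑ₖ α_{jk} ∇q_k`: the `L²(Ω)`-orthonormal harmonic vector fields obtained from
`∇q_1, …, ∇q_K` by the Gram-Schmidt procedure. -/
def etaField {K : ℕ} (Ω : Set E3) (q : Fin K → E3 → ℝ) (j : Fin K) : E3 → E3 :=
  ∑ k, alphaCoeff Ω q j k • ∇ (q k)

/-- The recursion of the Gram-Schmidt procedure:
`η_j = (∇q_j - ∑_{i<j} (∇q_j, η_i) η_i) / ‖∇q_j - ∑_{i<j} (∇q_j, η_i) η_i‖`. -/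
theorem etaField_eq {K : ℕ} (Ω : Set E3) (q : Fin K → E3 → ℝ) (j : Fin K) :
    etaField Ω q j =
      (l2Norm Ω (∇ (q j) -
        ∑ i ∈ Finset.Iio j, l2Inner Ω (∇ (q j)) (etaField Ω q i) • etaField Ω q i))⁻¹ •
      (∇ (q j) -
        ∑ i ∈ Finset.Iio j, l2Inner Ω (∇ (q j)) (etaField Ω q i) • etaField Ω q i) := by
  set v : Fin K → E3 → E3 := fun l => ∇ (q l) with hv
  have hη : ∀ i, etaField Ω q i = combination v (gramSchmidtCoeff Ω v i) := fun i => rfl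
  have hsub : ∀ a b : Fin K → ℝ, combination v (a - b) = combination v a - combination v b := by
    intro a b
    simp [combination, sub_smul, Finset.sum_sub_distrib]
  have hsmul : ∀ (c : ℝ) (a : Fin K → ℝ), combination v (c • a) = c • combination v a := by
    intro c a
    simp [combination, Finset.smul_sum, smul_smul]
  have hsum : ∀ (s : Finset (Fin K)) (a : Fin K → Fin K → ℝ),
      combination v (∑ i ∈ s, a i) = ∑ i ∈ s, combination v (a i) := by
    intro s a
    simp only [combination, Finset.sum_apply, Finset.sum_smul]
    exact Finset.sum_comm
  have hsingle : combination v (Pi.single j 1) = v j := by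
    simp [combination, Pi.single_apply]
  have hr : combination v (Pi.single j 1 - ∑ i : Finset.Iio j,
      l2Inner Ω (v j) (combination v (gramSchmidtCoeff Ω v i)) • gramSchmidtCoeff Ω v i) =
      v j - ∑ i ∈ Finset.Iio j, l2Inner Ω (v j) (etaField Ω q i) • etaField Ω q i := by
    rw [Finset.sum_coe_sort (Finset.Iio j) (fun i =>
      l2Inner Ω (v j) (combination v (gramSchmidtCoeff Ω v i)) • gramSchmidtCoeff Ω v i),
      hsub, hsingle, hsum]
    simp only [hsmul, hη]
  rw [hη j, gramSchmidtCoeff]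
  simp only [hsmul]
  rw [hr]

/-- The vector field `∑_{l,k} α_{kl} (∫_{Γ_l} b·ν dS) η_k` on `Ω`. -/
def harmonicPart {K : ℕ} (Ω : Set E3) (Γ : Fin (K + 1) → Set E3) (q : Fin K → E3 → ℝ)
    (b : E3 → E3) : E3 → E3 :=
  ∑ l : Fin K, ∑ k : Fin K, (alphaCoeff Ω q k l * flux Ω (Γ l.succ) b) • etaField Ω q k

/-- The constant `C_s = 3^{-1/2} 2^{2/3} π^{-2/3}`. -/
def sobolevConst : ℝ :=
  (3 : ℝ) ^ (-(1 / 2) : ℝ) * (2 : ℝ) ^ (2 / 3 : ℝ) * Real.pi ^ (-(2 / 3) : ℝ)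

/-- The smallness hypothesis of the existence theorem for time periodic solutions:
`sup_{0 ≤ t ≤ T} ‖∑_{l,k} α_{kl}(t) (∫_{Γ_l(t)} β(t)·ν(t) dS) η_k(t)‖_{L³(Ω(t))} < 1 / C_s`. -/
def SmallnessHypothesis {K : ℕ} (T : ℝ) (Ω : ℝ → Set E3) (Γ : ℝ → Fin (K + 1) → Set E3)
    (q : ℝ → Fin K → E3 → ℝ) (β : ℝ → E3 → E3) : Prop :=
  (⨆ t ∈ Icc (0 : ℝ) T,
      eLpNorm (harmonicPart (Ω t) (Γ t) (q t) (β t)) 3 (volume.restrict (Ω t))) <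
    ENNReal.ofReal (1 / sobolevConst)

end

/-
By the maximum principle the potentials `q_k` are determined by `Ω` and the labelling of the
boundary components. Under the dilation `Ω = c Ω₀` the gradients `∇q_k` scale by `c⁻¹` and the
Gram–Schmidt coefficients `α_{jk}` by `c^{-1/2}`, so that for prescribed fluxes the field
`∑ α_{kl} f_l η_k` scales by `c⁻²`; the change of variables in `L³` contributes a factor `c`, whence
its norm is `c⁻¹` times the one on `Ω₀`, where it is at most `M ∑ |f_l|` because `∇q_k` is bounded.
The Gram–Schmidt construction, and with it this estimate, depends on the order of the components,
but a set has only finitely many labellings by its components, so `M` can be chosen to depend on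
`Ω₀` alone.
-/

section MaximumPrinciple

theorem deriv_deriv_nonpos_of_isLocalMax {g : ℝ → ℝ} {x : ℝ} (hmax : IsLocalMax g x)
    (hg : ContinuousAt g x) : deriv (deriv g) x ≤ 0 := by
  by_contra! hpos
  have hmin : IsLocalMin g x := isLocalMin_of_deriv_deriv_pos hpos hmax.deriv_eq_zero hg
  have hconst : g =ᶠ[𝓝 x] fun _ => g x := by
    filter_upwards [hmax, hmin] with s hle hge using le_antisymm hle hge
  have hzero : deriv (deriv g) x = 0 := by simp [hconst.deriv.deriv_eq]
  exact hpos.ne' hzero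

variable {E : Type*} [NormedAddCommGroup E]

theorem deriv_deriv_comp_line [NormedSpace ℝ E] {u : E → ℝ} {z : E} (hu : ContDiffAt ℝ 2 u z)
    (e : E) : deriv (deriv fun s : ℝ => u (z + s • e)) 0 = iteratedFDeriv ℝ 2 u z ![e, e] := by
  have hline (s : ℝ) : HasDerivAt (fun r : ℝ => z + r • e) e s := by
    simpa using ((hasDerivAt_id s).smul_const e).const_add z
  have htendsto : Tendsto (fun r : ℝ => z + r • e) (𝓝 0) (𝓝 z) := by
    simpa using (hline 0).continuousAt.tendsto
  have hfirst : deriv (fun s : ℝ => u (z + s • e)) =ᶠ[𝓝 0] fun s => fderiv ℝ u (z + s • e) e := by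
    filter_upwards [htendsto.eventually (hu.eventually (by simp))] with s hs
    have hus : HasFDerivAt u (fderiv ℝ u (z + s • e)) (z + s • e) :=
      (hs.differentiableAt two_ne_zero).hasFDerivAt
    exact (HasFDerivAt.comp_hasDerivAt (f := fun r : ℝ => z + r • e) s hus (hline s)).deriv
  have hfderiv : DifferentiableAt ℝ (fderiv ℝ u) (z + (0 : ℝ) • e) := by
    simpa using (hu.fderiv_right (m := 1) (by norm_num)).differentiableAt one_ne_zero
  have hsecond := (HasFDerivAt.comp_hasDerivAt (f := fun r : ℝ => z + r • e) (0 : ℝ)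
    hfderiv.hasFDerivAt (hline 0)).clm_apply (hasDerivAt_const (0 : ℝ) e)
  rw [hfirst.deriv_eq, iteratedFDeriv_two_apply]
  simpa [Function.comp_def] using hsecond.deriv

theorem iteratedFDeriv_two_nonpos_of_isLocalMax [NormedSpace ℝ E] {u : E → ℝ} {z : E}
    (hu : ContDiffAt ℝ 2 u z) (hmax : IsLocalMax u z) (e : E) :
    iteratedFDeriv ℝ 2 u z ![e, e] ≤ 0 := by
  have hline : Tendsto (fun s : ℝ => z + s • e) (𝓝 0) (𝓝 z) :=
    Continuous.tendsto' (by fun_prop) 0 z (by simp)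
  have hlinemax : IsLocalMax (fun s : ℝ => u (z + s • e)) 0 := by
    filter_upwards [hline.eventually hmax] with s hs
    simpa using hs
  have hcont : ContinuousAt (fun s : ℝ => u (z + s • e)) 0 := by
    simpa [ContinuousAt, Function.comp_def] using hu.continuousAt.tendsto.comp hline
  exact (deriv_deriv_comp_line hu e).symm.trans_le
    (deriv_deriv_nonpos_of_isLocalMax hlinemax hcont)

variable [InnerProductSpace ℝ E] [FiniteDimensional ℝ E]

theorem laplacian_nonpos_of_isLocalMax {u : E → ℝ} {z : E} (hu : ContDiffAt ℝ 2 u z)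
    (hmax : IsLocalMax u z) : Δ u z ≤ 0 := by
  rw [InnerProductSpace.laplacian_eq_iteratedFDeriv_stdOrthonormalBasis]
  exact Finset.sum_nonpos fun i _ => iteratedFDeriv_two_nonpos_of_isLocalMax hu hmax _

theorem laplacian_norm_sq (x : E) : Δ (fun y : E => ‖y‖ ^ 2) x = 2 * Module.finrank ℝ E := by
  have hfirst : fderiv ℝ (fun y : E => ‖y‖ ^ 2) = (2 • innerSL ℝ : E →L[ℝ] E →L[ℝ] ℝ) :=
    funext fun y => (hasStrictFDerivAt_norm_sq y).hasFDerivAt.fderiv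
  have hsecond (e : E) : iteratedFDeriv ℝ 2 (fun y : E => ‖y‖ ^ 2) x ![e, e] = 2 * ‖e‖ ^ 2 := by
    rw [iteratedFDeriv_two_apply, hfirst, ContinuousLinearMap.fderiv]
    exact (nsmul_eq_mul 2 _).trans (congrArg (2 * ·) (real_inner_self_eq_norm_sq e))
  simp [InnerProductSpace.laplacian_eq_iteratedFDeriv_stdOrthonormalBasis, hsecond, mul_comm]

/- Adding `ε ‖x‖²` makes the Laplacian positive, which excludes interior maxima. -/
theorem le_of_laplacian_nonneg [Nontrivial E] {Ω : Set E} (hb : Bornology.IsBounded Ω)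
    {u : E → ℝ} {m : ℝ} (hc : ContinuousOn u (closure Ω))
    (hu : ∀ x ∈ interior Ω, ContDiffAt ℝ 2 u x) (hΔ : ∀ x ∈ interior Ω, 0 ≤ Δ u x)
    (hm : ∀ x ∈ frontier Ω, u x ≤ m) {x : E} (hx : x ∈ closure Ω) : u x ≤ m := by
  obtain ⟨R, hR⟩ := hb.closure.exists_norm_le
  have hbound {ε : ℝ} (hε : 0 < ε) : u x ≤ m + ε * R ^ 2 := by
    obtain ⟨z, hz, hzmax⟩ := hb.isCompact_closure.exists_isMaxOn ⟨x, hx⟩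
      (f := fun x => u x + ε * ‖x‖ ^ 2) (hc.add (by fun_prop))
    have hzfrontier : z ∈ frontier Ω := by
      refine ⟨hz, fun hzint => ?_⟩
      have hsq : ContDiffAt ℝ 2 (fun y : E => ‖y‖ ^ 2) z := (contDiff_norm_sq ℝ).contDiffAt
      have hεsq : ContDiffAt ℝ 2 (ε • fun y : E => ‖y‖ ^ 2) z := hsq.const_smul ε
      have hmax : IsLocalMax (u + ε • fun y : E => ‖y‖ ^ 2) z :=
        hzmax.isLocalMax (mem_of_superset (isOpen_interior.mem_nhds hzint)
          (interior_subset.trans subset_closure))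
      have hle : Δ (u + ε • fun y : E => ‖y‖ ^ 2) z ≤ 0 :=
        laplacian_nonpos_of_isLocalMax ((hu z hzint).add hεsq) hmax
      rw [(hu z hzint).laplacian_add hεsq, InnerProductSpace.laplacian_smul ε hsq,
        laplacian_norm_sq, smul_eq_mul] at hle
      have hdim : (0 : ℝ) < Module.finrank ℝ E := by exact_mod_cast Module.finrank_pos
      exact absurd hle (not_le.2 (add_pos_of_nonneg_of_pos (hΔ z hzint) (by positivity)))
    calc u x ≤ u x + ε * ‖x‖ ^ 2 := le_add_of_nonneg_right (by positivity)
      _ ≤ u z + ε * ‖z‖ ^ 2 := hzmax hx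
      _ ≤ m + ε * R ^ 2 := by gcongr; exacts [hm z hzfrontier, hR z hz]
  have hlim : Tendsto (fun ε : ℝ => m + ε * R ^ 2) (𝓝[>] 0) (𝓝 m) :=
    (Continuous.tendsto' (by fun_prop) 0 m (by simp)).mono_left nhdsWithin_le_nhds
  exact ge_of_tendsto hlim (eventually_mem_nhdsWithin.mono fun ε hε => hbound hε)

theorem eqOn_closure_of_harmonicContOnCl [Nontrivial E] {Ω : Set E} (hb : Bornology.IsBounded Ω)
    {u v : E → ℝ} (hu : InnerProductSpace.HarmonicContOnCl u Ω)
    (hv : InnerProductSpace.HarmonicContOnCl v Ω) (huv : EqOn u v (frontier Ω)) :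
    EqOn u v (closure Ω) := by
  have hle {u v : E → ℝ} (hu : InnerProductSpace.HarmonicContOnCl u Ω)
      (hv : InnerProductSpace.HarmonicContOnCl v Ω) (huv : EqOn u v (frontier Ω)) :
      ∀ x ∈ closure Ω, u x ≤ v x := fun x hx => by
    have hdiff := hu.sub hv
    refine sub_nonpos.1 (le_of_laplacian_nonneg hb hdiff.2
      (fun y hy => hdiff.contDiffAt (interior_subset hy))
      (fun y hy => (hdiff.1 y (interior_subset hy)).2.self_of_nhds.ge)
      (fun y hy => (sub_eq_zero.2 (huv hy)).le) hx)
  exact fun x hx => le_antisymm (hle hu hv huv x hx) (hle hv hu huv.symm x hx)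

end MaximumPrinciple

section GradientBound

variable {E F : Type*} [NormedAddCommGroup E] [NormedAddCommGroup F]

theorem exists_norm_fderiv_le_of_contDiffOn [NormedSpace ℝ E] [NormedSpace ℝ F] {s : Set E}
    (hs : IsCompact s) {u : E → F} (hu : ContDiffOn ℝ 1 u s) :
    ∃ B : ℝ, ∀ x ∈ interior s, ‖fderiv ℝ u x‖ ≤ B := by
  have hlocal : ∀ x ∈ s, ∃ t ∈ 𝓝[s] x, ∃ B : ℝ, ∀ y ∈ t ∩ interior s, ‖fderiv ℝ u y‖ ≤ B := by
    intro x hx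
    have hux : ContDiffWithinAt ℝ (0 + 1) u s x := by simpa using hu x hx
    obtain ⟨w, hw, -, -, u', hu', hu'c⟩ :=
      (contDiffWithinAt_succ_iff_hasFDerivWithinAt' (by simp)).1 hux
    rw [insert_eq_of_mem hx] at hw
    have hbound : ∀ᶠ y in 𝓝[s] x, ‖u' y‖ ≤ ‖u' x‖ + 1 :=
      hu'c.continuousWithinAt.norm.eventually_le_const (lt_add_one _)
    refine ⟨_, inter_mem hbound hw, ‖u' x‖ + 1, fun y ⟨⟨hy, hyw⟩, hys⟩ => ?_⟩
    rwa [((hu' y hyw).hasFDerivAt (mem_interior_iff_mem_nhds.1 hys)).fderiv]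
  obtain ⟨B, hB⟩ := hs.induction_on
    (p := fun t => ∃ B : ℝ, ∀ y ∈ t ∩ interior s, ‖fderiv ℝ u y‖ ≤ B) ⟨0, by simp⟩
    (fun _ _ hst ⟨B, hB⟩ => ⟨B, fun y hy => hB y ⟨hst hy.1, hy.2⟩⟩)
    (fun _ _ ⟨B, hB⟩ ⟨B', hB'⟩ => ⟨max B B', fun y hy => hy.1.elim
      (fun h => (hB y ⟨h, hy.2⟩).trans (le_max_left _ _))
      (fun h => (hB' y ⟨h, hy.2⟩).trans (le_max_right _ _))⟩) hlocal
  exact ⟨B, fun x hx => hB x ⟨interior_subset hx, hx⟩⟩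

theorem memLp_gradient_of_contDiffOn_closure [InnerProductSpace ℝ E] [FiniteDimensional ℝ E]
    [MeasurableSpace E] [BorelSpace E] (μ : Measure E) [IsFiniteMeasureOnCompacts μ] {Ω : Set E}
    (ho : IsOpen Ω) (hb : Bornology.IsBounded Ω) {u : E → ℝ} (hu : ContDiffOn ℝ 1 u (closure Ω))
    (p : ENNReal) : MemLp (∇ u) p (μ.restrict Ω) := by
  obtain ⟨B, hB⟩ := exists_norm_fderiv_le_of_contDiffOn hb.isCompact_closure hu
  have hcont : ContinuousOn (∇ u) Ω :=
    (InnerProductSpace.toDual ℝ E).symm.continuous.comp_continuousOn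
      ((hu.mono subset_closure).continuousOn_fderiv_of_isOpen ho le_rfl)
  have : IsFiniteMeasure (μ.restrict Ω) := ⟨by simpa using hb.measure_lt_top⟩
  refine MemLp.of_bound (hcont.aestronglyMeasurable ho.measurableSet) B ?_
  refine ae_restrict_of_forall_mem ho.measurableSet fun x hx => ?_
  rw [gradient, LinearIsometryEquiv.norm_map]
  exact hB x (ho.subset_interior_iff.2 subset_closure hx)

end GradientBound

section Dilation

variable {E F : Type*} [NormedAddCommGroup E] [InnerProductSpace ℝ E] [NormedAddCommGroup F]

theorem gradient_comp_smul [CompleteSpace E] (u : E → ℝ) (c : ℝ) (x : E) :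
    ∇ (fun y => u (c • y)) x = c • ∇ u (c • x) := by
  simp [gradient, fderiv_comp_smul]

theorem laplacian_comp_smul [NormedSpace ℝ F] [FiniteDimensional ℝ E] (u : E → F) (c : ℝ) (x : E) :
    Δ (fun y => u (c • y)) x = c ^ 2 • Δ u (c • x) := by
  have hfirst : (fderiv ℝ fun y => u (c • y)) = c • fun y => fderiv ℝ u (c • y) :=
    funext fun y => fderiv_comp_smul c
  have hsmul : fderiv ℝ (c • fun y => fderiv ℝ u (c • y)) =
      c • fderiv ℝ fun y => fderiv ℝ u (c • y) :=
    fderiv_const_smul_field (𝕜 := ℝ) (f := fun y => fderiv ℝ u (c • y)) c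
  have hcomp : fderiv ℝ (fun y => fderiv ℝ u (c • y)) x = c • fderiv ℝ (fderiv ℝ u) (c • x) :=
    fderiv_comp_smul c
  simp [InnerProductSpace.laplacian_eq_iteratedFDeriv_stdOrthonormalBasis,
    iteratedFDeriv_two_apply, hfirst, hsmul, hcomp, Finset.smul_sum, smul_smul, pow_two]

open scoped Pointwise in
theorem eLpNorm_restrict_smul [FiniteDimensional ℝ E] [MeasurableSpace E] [BorelSpace E]
    (μ : Measure E) [μ.IsAddHaarMeasure] (f : E → F) (s : Set E) {p : ENNReal} (hp : p ≠ ⊤)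
    {c : ℝ} (hc : 0 < c) :
    eLpNorm f p (μ.restrict (c • s)) =
      ENNReal.ofReal (c ^ Module.finrank ℝ E) ^ (1 / p).toReal *
        eLpNorm (fun x => f (c • x)) p (μ.restrict s) := by
  have hemb : MeasurableEmbedding (fun x : E => c • x) :=
    (Homeomorph.smulOfNeZero c hc.ne').measurableEmbedding
  have hd : 0 < c ^ Module.finrank ℝ E := pow_pos hc _
  have hμ : μ = ENNReal.ofReal (c ^ Module.finrank ℝ E) • μ.map (fun x => c • x) := by
    rw [Measure.map_addHaar_smul μ hc.ne', smul_smul, abs_of_pos (inv_pos.2 hd),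
      ← ENNReal.ofReal_mul hd.le, mul_inv_cancel₀ hd.ne', ENNReal.ofReal_one, one_smul]
  have hpreimage : (fun x : E => c • x) ⁻¹' (c • s) = s := by
    rw [preimage_smul₀ hc.ne', inv_smul_smul₀ hc.ne']
  conv_lhs => rw [hμ, Measure.restrict_smul, hemb.restrict_map, hpreimage]
  rw [eLpNorm_smul_measure_of_ne_top hp, hemb.eLpNorm_map_measure, smul_eq_mul,
    Function.comp_def]

end Dilation

section Partition

variable {X Y ι κ : Type*} [TopologicalSpace X] [TopologicalSpace Y]

/-- A partition of `S` into closed connected sets, indexed by `ι`. For finite `ι` these sets are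
the connected components of `S`, so that the partition is unique up to relabelling. -/
structure IsClosedConnectedPartition (S : Set X) (A : ι → Set X) : Prop where
  isClosed : ∀ i, IsClosed (A i)
  isConnected : ∀ i, IsConnected (A i)
  pairwise_disjoint : Pairwise (Function.onFun Disjoint A)
  iUnion_eq : ⋃ i, A i = S

namespace IsClosedConnectedPartition

variable {S : Set X} {A : ι → Set X} {B : κ → Set X}

theorem preimage (hA : IsClosedConnectedPartition S A) (e : Y ≃ₜ X) :
    IsClosedConnectedPartition (e ⁻¹' S) fun i => e ⁻¹' A i where
  isClosed i := (hA.isClosed i).preimage e.continuous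
  isConnected i := e.isConnected_preimage.2 (hA.isConnected i)
  pairwise_disjoint _ _ hij := (hA.pairwise_disjoint hij).preimage e
  iUnion_eq := by rw [← preimage_iUnion, hA.iUnion_eq]

theorem injective (hA : IsClosedConnectedPartition S A) : Function.Injective A := by
  intro i j hij
  by_contra hne
  have hdisj : Disjoint (A i) (A j) := hA.pairwise_disjoint hne
  rw [← hij, disjoint_self] at hdisj
  exact (hA.isConnected i).nonempty.ne_empty hdisj

theorem connectedComponentIn_eq [Finite ι] (hA : IsClosedConnectedPartition S A) {i : ι} {x : X}
    (hx : x ∈ A i) : connectedComponentIn S x = A i := by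
  have hAS : A i ⊆ S := hA.iUnion_eq ▸ subset_iUnion A i
  have hothers : IsClosed (⋃ j : {j // j ≠ i}, A j) :=
    isClosed_iUnion_of_finite fun j => hA.isClosed j
  have hcover : S ⊆ A i ∪ ⋃ j : {j // j ≠ i}, A j := by
    rw [← hA.iUnion_eq]
    refine iUnion_subset fun j => ?_
    rcases eq_or_ne j i with rfl | hji
    · exact subset_union_left
    · exact subset_union_of_subset_right
        (subset_iUnion (fun l : {l // l ≠ i} => A l) ⟨j, hji⟩) _
  have hdisj : Disjoint (A i) (⋃ j : {j // j ≠ i}, A j) :=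
    disjoint_iUnion_right.2 fun j => hA.pairwise_disjoint j.2.symm
  refine Subset.antisymm ?_
    ((hA.isConnected i).isPreconnected.subset_connectedComponentIn hx hAS)
  refine (isPreconnected_iff_subset_of_disjoint_closed.1 isPreconnected_connectedComponentIn _ _
    (hA.isClosed i) hothers ((connectedComponentIn_subset S x).trans hcover)
    (by rw [hdisj.inter_eq, inter_empty])).resolve_right fun hsub => ?_
  exact hdisj.notMem_of_mem_left hx (hsub (mem_connectedComponentIn (hAS hx)))

theorem range_eq [Finite ι] (hA : IsClosedConnectedPartition S A) :
    range A = connectedComponentIn S '' S := by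
  ext C
  constructor
  · rintro ⟨i, rfl⟩
    obtain ⟨x, hx⟩ := (hA.isConnected i).nonempty
    exact ⟨x, hA.iUnion_eq ▸ mem_iUnion_of_mem i hx, hA.connectedComponentIn_eq hx⟩
  · rintro ⟨x, hx, rfl⟩
    obtain ⟨i, hi⟩ := mem_iUnion.1 (hA.iUnion_eq.symm ▸ hx)
    exact ⟨i, (hA.connectedComponentIn_eq hi).symm⟩

theorem exists_equiv [Finite ι] [Finite κ] (hA : IsClosedConnectedPartition S A)
    (hB : IsClosedConnectedPartition S B) : ∃ e : ι ≃ κ, A = B ∘ e :=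
  ⟨(Equiv.ofInjective A hA.injective).trans <|
      (Equiv.setCongr (hA.range_eq.trans hB.range_eq.symm)).trans
        (Equiv.ofInjective B hB.injective).symm,
    funext fun i => by simp [Equiv.apply_ofInjective_symm]⟩

end IsClosedConnectedPartition

end Partition

section GramSchmidt

variable {K : ℕ} {Ω Ω' : Set E3} {v w : Fin K → E3 → E3}

theorem combination_single (v : Fin K → E3 → E3) (j : Fin K) :
    combination v (Pi.single j 1) = v j := by
  simp [combination, Pi.single_apply]

theorem combination_smul (v : Fin K → E3 → E3) (s : ℝ) (a : Fin K → ℝ) :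
    combination v (s • a) = s • combination v a := by
  simp [combination, Finset.smul_sum, smul_smul]

theorem l2Inner_smul_left (Ω : Set E3) (s : ℝ) (u v : E3 → E3) :
    l2Inner Ω (s • u) v = s * l2Inner Ω u v := by
  simp [l2Inner, inner_smul_left, integral_const_mul]

theorem l2Inner_smul_right (Ω : Set E3) (s : ℝ) (u v : E3 → E3) :
    l2Inner Ω u (s • v) = s * l2Inner Ω u v := by
  simp [l2Inner, inner_smul_right, integral_const_mul]

theorem gramSchmidtCoeff_eq_smul {r : ℝ} (hr : 0 < r)
    (hvw : ∀ a b, l2Inner Ω' (combination v a) (combination v b) =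
      r * l2Inner Ω (combination w a) (combination w b)) (j : Fin K) :
    gramSchmidtCoeff Ω' v j = (√r)⁻¹ • gramSchmidtCoeff Ω w j := by
  induction j using WellFoundedLT.induction with
  | ind j ih =>
  have hprojection (i : Finset.Iio j) :
      l2Inner Ω' (v j) (combination v (gramSchmidtCoeff Ω' v i)) • gramSchmidtCoeff Ω' v i =
        l2Inner Ω (w j) (combination w (gramSchmidtCoeff Ω w i)) • gramSchmidtCoeff Ω w i := by
    have hsqrt : (√r)⁻¹ * (r * (√r)⁻¹) = 1 := by
      field_simp
      exact (Real.sq_sqrt hr.le).symm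
    rw [ih i (Finset.mem_Iio.1 i.2), combination_smul, l2Inner_smul_right,
      ← combination_single v j, hvw, combination_single, smul_smul]
    congr 1
    linear_combination
      l2Inner Ω (w j) (combination w (gramSchmidtCoeff Ω w i)) * hsqrt
  rw [gramSchmidtCoeff, gramSchmidtCoeff]
  simp only [hprojection]
  rw [l2Norm, l2Norm, hvw, Real.sqrt_mul hr.le, mul_inv, mul_smul]

end GramSchmidt

section HarmonicField

variable {K : ℕ}

/-- The combination `∑_{l,k} α_{kl} f_l η_k` of the gradients of the potentials `q`: for the
potentials of the boundary components `Γ_1, …, Γ_K`, the harmonic field whose flux through each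
`Γ_l` is `f_l`. The fluxes are arbitrary numbers, so that the estimates below do not depend on how
a flux is defined. -/
noncomputable def harmonicFieldOfFlux (Ω : Set E3) (q : Fin K → E3 → ℝ) (f : Fin K → ℝ) : E3 → E3 :=
  ∑ l, ∑ k, (alphaCoeff Ω q k l * f l) • etaField Ω q k

section Congruence

variable {Ω : Set E3} {p q : Fin K → E3 → ℝ}

theorem alphaCoeff_congr (hΩ : MeasurableSet Ω) (hpq : ∀ k, EqOn (∇ (p k)) (∇ (q k)) Ω) :
    alphaCoeff Ω p = alphaCoeff Ω q := by
  have hcombination (a : Fin K → ℝ) :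
      EqOn (combination (fun k => ∇ (p k)) a) (combination (fun k => ∇ (q k)) a) Ω := by
    intro x hx
    simp [combination, hpq _ hx]
  have hinner (a b : Fin K → ℝ) :
      l2Inner Ω (combination (fun k => ∇ (p k)) a) (combination (fun k => ∇ (p k)) b) =
        1 * l2Inner Ω (combination (fun k => ∇ (q k)) a) (combination (fun k => ∇ (q k)) b) := by
    rw [one_mul]
    exact setIntegral_congr_fun hΩ fun x hx => by
      simp only [hcombination a hx, hcombination b hx]
  ext j k
  simp [alphaCoeff, gramSchmidtCoeff_eq_smul one_pos hinner]

theorem harmonicFieldOfFlux_congr (hΩ : MeasurableSet Ω)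
    (hpq : ∀ k, EqOn (∇ (p k)) (∇ (q k)) Ω) (f : Fin K → ℝ) :
    EqOn (harmonicFieldOfFlux Ω p f) (harmonicFieldOfFlux Ω q f) Ω := by
  intro x hx
  simp [harmonicFieldOfFlux, etaField, alphaCoeff_congr hΩ hpq, hpq _ hx]

end Congruence

section Dilation

open scoped Pointwise

variable {c : ℝ} (hc : 0 < c) (Ω : Set E3) (q : Fin K → E3 → ℝ)

include hc

theorem l2Inner_smul_set (u v : E3 → E3) :
    l2Inner (c • Ω) u v = c ^ 3 * l2Inner Ω (fun x => u (c • x)) (fun x => v (c • x)) := by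
  have hintegral := Measure.setIntegral_comp_smul_of_pos volume (fun x => inner ℝ (u x) (v x)) Ω hc
  rw [finrank_euclideanSpace_fin, smul_eq_mul] at hintegral
  rw [l2Inner, l2Inner, hintegral, mul_inv_cancel_left₀ (pow_pos hc 3).ne']

theorem alphaCoeff_smul_set (j k : Fin K) :
    alphaCoeff (c • Ω) q j k = (√c)⁻¹ * alphaCoeff Ω (fun l x => q l (c • x)) j k := by
  have hcombination (a : Fin K → ℝ) : combination (fun l => ∇ fun x => q l (c • x)) a =
      c • fun x => combination (fun l => ∇ (q l)) a (c • x) := by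
    ext1 x
    simp [combination, gradient_comp_smul, Finset.smul_sum, smul_comm c]
  refine congrFun (gramSchmidtCoeff_eq_smul hc (fun a b => ?_) j) k
  rw [hcombination, hcombination, l2Inner_smul_left, l2Inner_smul_right, l2Inner_smul_set hc]
  ring

theorem etaField_smul_set (j : Fin K) (x : E3) :
    etaField (c • Ω) q j (c • x) =
      ((√c)⁻¹ * c⁻¹) • etaField Ω (fun l x => q l (c • x)) j x := by
  have hgradient (k : Fin K) : ∇ (q k) (c • x) = c⁻¹ • ∇ (fun x => q k (c • x)) x := by
    rw [gradient_comp_smul, inv_smul_smul₀ hc.ne']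
  simp only [etaField, Finset.sum_apply, Pi.smul_apply, alphaCoeff_smul_set hc, hgradient,
    Finset.smul_sum, smul_smul]
  exact Finset.sum_congr rfl fun k _ => congrArg (· • _) (by ring)

theorem harmonicFieldOfFlux_smul_set (f : Fin K → ℝ) (x : E3) :
    harmonicFieldOfFlux (c • Ω) q f (c • x) =
      c⁻¹ ^ 2 • harmonicFieldOfFlux Ω (fun l x => q l (c • x)) f x := by
  have hsqrt : (√c)⁻¹ * (√c)⁻¹ = c⁻¹ := by rw [← mul_inv, Real.mul_self_sqrt hc.le]
  simp only [harmonicFieldOfFlux, Finset.sum_apply, Pi.smul_apply, alphaCoeff_smul_set hc,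
    etaField_smul_set hc, Finset.smul_sum, smul_smul]
  refine Finset.sum_congr rfl fun l _ => Finset.sum_congr rfl fun k _ => congrArg (· • _) ?_
  linear_combination c⁻¹ * alphaCoeff Ω (fun l x => q l (c • x)) k l * f l * hsqrt

theorem eLpNorm_harmonicFieldOfFlux_smul_set (f : Fin K → ℝ) :
    eLpNorm (harmonicFieldOfFlux (c • Ω) q f) 3 (volume.restrict (c • Ω)) =
      ENNReal.ofReal c⁻¹ *
        eLpNorm (harmonicFieldOfFlux Ω (fun l x => q l (c • x)) f) 3 (volume.restrict Ω) := by
  have hfield : (fun x => harmonicFieldOfFlux (c • Ω) q f (c • x)) =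
      c⁻¹ ^ 2 • harmonicFieldOfFlux Ω (fun l x => q l (c • x)) f :=
    funext (harmonicFieldOfFlux_smul_set hc Ω q f)
  have hroot : ENNReal.ofReal (c ^ 3) ^ (1 / (3 : ENNReal)).toReal = ENNReal.ofReal c := by
    rw [ENNReal.ofReal_pow hc.le, ← ENNReal.rpow_natCast_mul]
    simp
  rw [eLpNorm_restrict_smul volume _ Ω (by simp) hc, hfield, eLpNorm_const_smul,
    finrank_euclideanSpace_fin, hroot, Real.enorm_of_nonneg (by positivity), ← mul_assoc,
    ← ENNReal.ofReal_mul hc.le]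
  congr 2
  field_simp

end Dilation

theorem exists_eLpNorm_harmonicFieldOfFlux_le {μ : Measure E3} {r : ENNReal} (hr : 1 ≤ r)
    (Ω : Set E3) {q : Fin K → E3 → ℝ} (hq : ∀ k, MemLp (∇ (q k)) r μ) :
    ∃ M : NNReal, ∀ f, eLpNorm (harmonicFieldOfFlux Ω q f) r μ ≤ M * ∑ l, ‖f l‖ₑ := by
  have hη (k : Fin K) : MemLp (etaField Ω q k) r μ :=
    memLp_finsetSum' _ fun m _ => (hq m).const_smul _
  set w : Fin K → E3 → E3 := fun l => ∑ k, alphaCoeff Ω q k l • etaField Ω q k with hw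
  have hwr (l : Fin K) : MemLp (w l) r μ :=
    memLp_finsetSum' _ fun k _ => (hη k).const_smul _
  have hfield (f : Fin K → ℝ) : harmonicFieldOfFlux Ω q f = ∑ l, f l • w l := by
    simp only [harmonicFieldOfFlux, hw, Finset.smul_sum, smul_smul, mul_comm]
  refine ⟨∑ l, (eLpNorm (w l) r μ).toNNReal, fun f => ?_⟩
  rw [ENNReal.ofNNReal_finsetSum,
    Finset.sum_congr rfl fun l _ => ENNReal.coe_toNNReal (hwr l).eLpNorm_ne_top, hfield,
    Finset.mul_sum]
  refine (eLpNorm_sum_le (fun l _ => ((hwr l).const_smul _).aestronglyMeasurable) hr).trans ?_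
  refine Finset.sum_le_sum fun l hl => ?_
  rw [eLpNorm_const_smul, mul_comm]
  gcongr
  exact Finset.single_le_sum (f := fun l => eLpNorm (w l) r μ) (fun _ _ => zero_le) hl

end HarmonicField

section Potentials

variable {K : ℕ} {Ω : Set E3}

theorem IsBoundaryLabelling.isClosedConnectedPartition {Γ : Fin (K + 1) → Set E3}
    (hΓ : IsBoundaryLabelling Ω Γ) : IsClosedConnectedPartition (frontier Ω) Γ :=
  ⟨hΓ.isClosed, hΓ.isConnected, fun k l => hΓ.disjoint k l, hΓ.iUnion_eq⟩

namespace IsHarmonicPotential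

variable {Γ : Fin (K + 1) → Set E3} {k : Fin K} {p q : E3 → ℝ}

open scoped Pointwise in
theorem comp_smul {c : ℝ} (hq : IsHarmonicPotential (c • Ω) Γ k q) :
    IsHarmonicPotential Ω (fun j => (fun x => c • x) ⁻¹' Γ j) k fun x => q (c • x) where
  smooth := hq.smooth.comp (contDiff_const_smul c).contDiffOn fun _ hx =>
    image_closure_subset_closure_image (continuous_const_smul c) (mem_image_of_mem _ hx)
  harmonic x hx := by
    rw [laplacian_comp_smul, hq.harmonic _ (smul_mem_smul_set hx), smul_zero]
  boundary j x hx := hq.boundary j (c • x) hx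

theorem harmonicContOnCl (ho : IsOpen Ω) (hq : IsHarmonicPotential Ω Γ k q) :
    InnerProductSpace.HarmonicContOnCl q Ω where
  harmonicOnNhd _ hx :=
    ⟨((hq.smooth.mono subset_closure).contDiffAt (ho.mem_nhds hx)).of_le ENat.LEInfty.out,
      eventually_of_mem (ho.mem_nhds hx) hq.harmonic⟩
  continuousOn := hq.smooth.continuousOn

theorem eqOn (ho : IsOpen Ω) (hb : Bornology.IsBounded Ω) (hΓ : ⋃ j, Γ j = frontier Ω)
    (hp : IsHarmonicPotential Ω Γ k p) (hq : IsHarmonicPotential Ω Γ k q) :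
    EqOn p q (closure Ω) := by
  refine eqOn_closure_of_harmonicContOnCl hb (hp.harmonicContOnCl ho) (hq.harmonicContOnCl ho) ?_
  rw [← hΓ]
  intro x hx
  obtain ⟨j, hj⟩ := mem_iUnion.1 hx
  rw [hp.boundary j x hj, hq.boundary j x hj]

theorem eqOn_gradient (ho : IsOpen Ω) (hb : Bornology.IsBounded Ω) (hΓ : ⋃ j, Γ j = frontier Ω)
    (hp : IsHarmonicPotential Ω Γ k p) (hq : IsHarmonicPotential Ω Γ k q) :
    EqOn (∇ p) (∇ q) Ω := fun _ hx =>
  (((hp.eqOn ho hb hΓ hq).mono subset_closure).eventuallyEq_of_mem (ho.mem_nhds hx)).gradient_eq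

end IsHarmonicPotential

end Potentials

section Uniformity

variable {Ω : Set E3} {r : ENNReal}

theorem exists_eLpNorm_harmonicFieldOfFlux_le_of_labelling {K : ℕ} {Γ : Fin (K + 1) → Set E3}
    (ho : IsOpen Ω) (hb : Bornology.IsBounded Ω) (hΓ : ⋃ j, Γ j = frontier Ω) (hr : 1 ≤ r) :
    ∃ M : NNReal, ∀ q f, (∀ k, IsHarmonicPotential Ω Γ k (q k)) →
      eLpNorm (harmonicFieldOfFlux Ω q f) r (volume.restrict Ω) ≤ M * ∑ l, ‖f l‖ₑ := by
  by_cases hp : ∃ p : Fin K → E3 → ℝ, ∀ k, IsHarmonicPotential Ω Γ k (p k)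
  · obtain ⟨p, hp⟩ := hp
    obtain ⟨M, hM⟩ := exists_eLpNorm_harmonicFieldOfFlux_le hr Ω fun k =>
      memLp_gradient_of_contDiffOn_closure volume ho hb
        ((hp k).smooth.of_le ENat.LEInfty.out) r
    refine ⟨M, fun q f hq => (eLpNorm_congr_ae ?_).trans_le (hM f)⟩
    exact ae_restrict_of_forall_mem ho.measurableSet <|
      harmonicFieldOfFlux_congr ho.measurableSet
        (fun k => (hq k).eqOn_gradient ho hb hΓ (hp k)) f
  · exact ⟨0, fun q _ hq => (hp ⟨q, hq⟩).elim⟩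

theorem exists_eLpNorm_harmonicFieldOfFlux_le_of_isClosedConnectedPartition
    (ho : IsOpen Ω) (hb : Bornology.IsBounded Ω) (hr : 1 ≤ r) :
    ∃ M : NNReal, ∀ (K : ℕ) (Γ : Fin (K + 1) → Set E3) (q : Fin K → E3 → ℝ) (f : Fin K → ℝ),
      IsClosedConnectedPartition (frontier Ω) Γ → (∀ k, IsHarmonicPotential Ω Γ k (q k)) →
      eLpNorm (harmonicFieldOfFlux Ω q f) r (volume.restrict Ω) ≤ M * ∑ l, ‖f l‖ₑ := by
  by_cases hA : ∃ (K : ℕ) (A : Fin (K + 1) → Set E3), IsClosedConnectedPartition (frontier Ω) A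
  · obtain ⟨K₀, A, hA⟩ := hA
    choose M hM using fun σ : Equiv.Perm (Fin (K₀ + 1)) =>
      exists_eLpNorm_harmonicFieldOfFlux_le_of_labelling (Γ := A ∘ σ) ho hb
        ((σ.surjective.iUnion_comp A).trans hA.iUnion_eq) hr
    obtain ⟨N, hN⟩ := Finite.exists_le M
    refine ⟨N, fun K Γ q f hΓ hq => ?_⟩
    obtain ⟨σ, rfl⟩ := hΓ.exists_equiv hA
    obtain rfl : K = K₀ := by simpa using Fintype.card_congr σ
    exact (hM σ q f hq).trans (by gcongr; exact hN σ)
  · exact ⟨0, fun K Γ _ _ hΓ => (hA ⟨K, Γ, hΓ⟩).elim⟩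

open scoped Pointwise in
theorem exists_eLpNorm_harmonicFieldOfFlux_smul_set_le (ho : IsOpen Ω)
    (hb : Bornology.IsBounded Ω) :
    ∃ M : NNReal, ∀ (K : ℕ) (c : ℝ) (Γ : Fin (K + 1) → Set E3) (q : Fin K → E3 → ℝ)
      (f : Fin K → ℝ), 0 < c → IsClosedConnectedPartition (frontier (c • Ω)) Γ →
      (∀ k, IsHarmonicPotential (c • Ω) Γ k (q k)) →
      eLpNorm (harmonicFieldOfFlux (c • Ω) q f) 3 (volume.restrict (c • Ω)) ≤
        ENNReal.ofReal (M * (c⁻¹ * ∑ l, |f l|)) := by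
  obtain ⟨M, hM⟩ := exists_eLpNorm_harmonicFieldOfFlux_le_of_isClosedConnectedPartition
    (r := 3) ho hb (by norm_num)
  refine ⟨M, fun K c Γ q f hc hΓ hq => ?_⟩
  let e : E3 ≃ₜ E3 := Homeomorph.smulOfNeZero c hc.ne'
  have hfrontier : e ⁻¹' frontier (c • Ω) = frontier Ω := by
    rw [e.preimage_frontier]
    exact congrArg frontier (preimage_image_eq Ω e.injective)
  have hΓ' : IsClosedConnectedPartition (frontier Ω) fun j => e ⁻¹' Γ j := hfrontier ▸ hΓ.preimage e
  calc eLpNorm (harmonicFieldOfFlux (c • Ω) q f) 3 (volume.restrict (c • Ω))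
      = ENNReal.ofReal c⁻¹ *
          eLpNorm (harmonicFieldOfFlux Ω (fun l x => q l (c • x)) f) 3 (volume.restrict Ω) :=
        eLpNorm_harmonicFieldOfFlux_smul_set hc Ω q f
    _ ≤ ENNReal.ofReal c⁻¹ * (M * ∑ l, ‖f l‖ₑ) := by
        gcongr
        exact hM K _ _ f hΓ' fun k => (hq k).comp_smul
    _ = ENNReal.ofReal (M * (c⁻¹ * ∑ l, |f l|)) := by
        rw [ENNReal.ofReal_mul M.coe_nonneg, ENNReal.ofReal_mul (inv_pos.2 hc).le,
          ENNReal.ofReal_sum_of_nonneg fun l _ => abs_nonneg (f l), ENNReal.ofReal_coe_nnreal,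
          mul_left_comm]
        simp only [← Real.norm_eq_abs, ofReal_norm]

end Uniformity

theorem sobolevConst_pos : 0 < sobolevConst := by
  unfold sobolevConst
  positivity

theorem mainTheorem9_general (Ω₀ : Set E3) {ε : ℝ} (hε : 0 < ε) :
    ∃ C₀ : ℝ, 0 < C₀ ∧
      ∀ (I : Set ℝ) (K : ℕ) (Ω : ℝ → Set E3) (Γ : ℝ → Fin (K + 1) → Set E3) (lam : ℝ → ℝ)
        (q : ℝ → Fin K → E3 → ℝ) (f : ℝ → Fin K → ℝ),
        IsOpen Ω₀ →
        Bornology.IsBounded Ω₀ →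
        (∀ t ∈ I, 0 < lam t) →
        (∀ t ∈ I, Ω t = (fun x => lam t • x) '' Ω₀) →
        (∀ t ∈ I, IsClosedConnectedPartition (frontier (Ω t)) (Γ t)) →
        (∀ t ∈ I, ∀ k, IsHarmonicPotential (Ω t) (Γ t) k (q t k)) →
        (∀ t ∈ I, (lam t)⁻¹ * ∑ k, |f t k| < C₀) →
        (⨆ t ∈ I, eLpNorm (harmonicFieldOfFlux (Ω t) (q t) (f t)) 3 (volume.restrict (Ω t))) <
          ENNReal.ofReal ε := by
  by_cases hΩ₀ : IsOpen Ω₀ ∧ Bornology.IsBounded Ω₀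
  · obtain ⟨M, hM⟩ := exists_eLpNorm_harmonicFieldOfFlux_smul_set_le hΩ₀.1 hΩ₀.2
    have hM₁ : (0 : ℝ) < M + 1 := by positivity
    refine ⟨ε / 2 / (M + 1), by positivity,
      fun I K Ω Γ lam q f _ _ hlam hΩ hΓ hq hf => lt_of_le_of_lt (iSup₂_le fun t ht => ?_)
        ((ENNReal.ofReal_lt_ofReal_iff hε).2 (half_lt_self hε))⟩
    have hnonneg : 0 ≤ (lam t)⁻¹ * ∑ k, |f t k| :=
      mul_nonneg (inv_pos.2 (hlam t ht)).le (Finset.sum_nonneg fun k _ => abs_nonneg _)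
    have hsmall : M * ((lam t)⁻¹ * ∑ k, |f t k|) ≤ ε / 2 := by
      have := (lt_div_iff₀ hM₁).1 (hf t ht)
      linarith
    have hΓt := hΓ t ht
    have hqt := hq t ht
    rw [hΩ t ht] at hΓt hqt ⊢
    exact (hM K _ _ _ _ (hlam t ht) hΓt hqt).trans (ENNReal.ofReal_le_ofReal hsmall)
  · exact ⟨1, one_pos, fun _ _ _ _ _ _ _ ho hb => (hΩ₀ ⟨ho, hb⟩).elim⟩

theorem mainTheorem9 (Ω₀ : Set E3) :
    ∃ C₀ : ℝ, 0 < C₀ ∧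
      ∀ (T : ℝ) (K : ℕ) (Ω : ℝ → Set E3) (Γ : ℝ → Fin (K + 1) → Set E3)
        (Ω' : Set E3) (φ ψ : E3 × ℝ → E3) (lam : ℝ → ℝ) (q : ℝ → Fin K → E3 → ℝ)
        (β : ℝ → E3 → E3),
        0 < T →
        -- the family of domains, and the periodicity of the diffeomorphism
        IsAdmissibleFamily Ω Γ Ω' φ ψ →
        (∀ t, ∀ y ∈ closure Ω', ψ (y, t + T) = ψ (y, t)) →
        -- the dilation
        Ω 0 = Ω₀ →
        ContDiff ℝ ∞ lam →
        (∀ t, 0 < lam t) →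
        (∀ t, lam (t + T) = lam t) →
        (∀ t, Ω t = (fun x => lam t • x) '' Ω 0) →
        -- `q_1(t), …, q_K(t)` are the solutions of the Dirichlet problems on `Ω(t)`
        (∀ t k, IsHarmonicPotential (Ω t) (Γ t) k (q t k)) →
        -- the boundary data
        (∀ t, MemHHalf (frontier (Ω t)) (β t)) →
        (∀ t, flux (Ω t) (frontier (Ω t)) (β t) = 0) →
        IsC1HHalf (frontier Ω') (transformField Ω φ ψ β) →
        (∀ t, β (t + T) =ᵐ[surfaceMeasure.restrict (frontier (Ω t))] β t) →
        (∀ t ∈ Icc (0 : ℝ) T,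
          (lam t)⁻¹ * ∑ k : Fin K, |flux (Ω t) (Γ t k.succ) (β t)| < C₀) →
        SmallnessHypothesis T Ω Γ q β := by
  obtain ⟨C₀, hC₀, hsup⟩ := mainTheorem9_general Ω₀ (one_div_pos.2 sobolevConst_pos)
  refine ⟨C₀, hC₀, ?_⟩
  rintro T K Ω Γ Ω' φ ψ lam q β - hΩ - rfl - hlam - hdil hq - - - - hflux
  exact hsup (Icc 0 T) K Ω Γ lam q (fun t l => flux (Ω t) (Γ t l.succ) (β t))
    (hΩ.domain 0).isOpen (hΩ.domain 0).isBounded (fun t _ => hlam t) (fun t _ => hdil t)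
    (fun t _ => (hΩ.boundary t).isClosedConnectedPartition) (fun t _ => hq t) hflux
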